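/- For $f \in L^1(\mathbb{R})$ (complex-valued) write $\hat f(\gamma) = \int_{\mathbb{R}} f(x) e^{-i\gamma x}\,dx$ for $\gamma\in\mathbb{R}$, and $f^*(x) = \overline{f(-x)}$. For $\varphi \in L^\infty(\mathbb{R})$ (complex-valued) let $I(\varphi) = \{ f \in L^1(\mathbb{R}) : f^* * \varphi = 0 \text{ a.e.} \}$, and define the spectrum of $\varphi$ by $$sp(\varphi) = \{ \gamma \in \mathbb{R} : \hat f(\gamma) = 0 \text{ for all } f \in I(\varphi) \}.$$ Corollary 5.4. If $\varphi \in L^\infty(\mathbb{R})$ and $0 \notin sp(\varphi)$, then the indefinite integral $P\varphi(x) = \int_0^x \varphi(t)\,dt$ is bounded on $\mathbb{R}$. -/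

import Mathlib

open MeasureTheory

open scoped ComplexConjugate Convolution

namespace BeurlingSpectrum

noncomputable section

/-- The Fourier transform `f̂(γ) = ∫ f(x) e^{-iγx} dx` of `f ∈ L¹(ℝ)`; the dual group of `ℝ` is
identified with `ℝ` by letting `γ` act as the character `x ↦ e^{iγx}`. -/
def fourierHat (f : ℝ → ℂ) (γ : ℝ) : ℂ :=
  ∫ x : ℝ, f x * Complex.exp (-(Complex.I * γ * x))

/-- The involution `f*(x) = conj (f (-x))`. -/
def invol (f : ℝ → ℂ) : ℝ → ℂ := fun x => conj (f (-x))

/-- `I(φ)`: the integrable functions `f` with `f* * φ = 0` almost everywhere. -/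
def annihilator (φ : ℝ → ℂ) : Set (ℝ → ℂ) :=
  {f | Integrable f volume ∧
    (invol f ⋆[ContinuousLinearMap.mul ℝ ℂ, volume] φ) =ᵐ[volume] 0}

/-- The spectrum `sp(φ)` relative to `L¹(ℝ)`: the hull of the ideal `I(φ)`. -/
def sp (φ : ℝ → ℂ) : Set ℝ :=
  {γ | ∀ f ∈ annihilator φ, fourierHat f γ = 0}

/-- The indefinite integral `Pφ(x) = ∫₀ˣ φ(t) dt`. -/
def indefiniteIntegral (φ : ℝ → ℂ) (x : ℝ) : ℂ :=
  ∫ t in (0 : ℝ)..x, φ t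

end

end BeurlingSpectrum

/-! Since `0 ∉ sp φ`, some `g = f*` has `g * φ = 0` and `∫ g ≠ 0`. For each `h`, `u x = ∫ s in
x..x+h, φ s` is bounded and satisfies `g * u = 0`, with a Lipschitz constant independent of `h`. So
`exists_norm_le_of_convolution_eq_zero` bounds `u 0`, the primitive at `h`, uniformly in `h`. That
lemma rests on `c * u x = ∫ g t * (u x - u (x - t))`. -/

/-- A bounded `L`-Lipschitz solution `u` of `g * u = 0`, where `∫ g ≠ 0`, is bounded by a constant
which depends only on `g` and `L`. -/
theorem exists_norm_le_of_convolution_eq_zero {g : ℝ → ℂ} (hg : Integrable g volume)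
    (hg0 : ∫ t, g t ≠ 0) (L : ℝ) :
    ∃ K : ℝ, ∀ u : ℝ → ℂ, Continuous u → (∃ B, ∀ x, ‖u x‖ ≤ B) →
      (∀ x t, ‖u x - u (x - t)‖ ≤ L * |t|) → (∀ x, ∫ t, g t * u (x - t) = 0) →
      ∀ x, ‖u x‖ ≤ K := by
  set c := ∫ t, g t
  have hc : 0 < ‖c‖ := norm_pos_iff.2 hg0
  -- Compact support gives `k` a finite first moment, so the Lipschitz bound applies to it. As `‖u x
  -- - u (x - t)‖ ≤ 2 * S`, the error `‖c‖ / 4` costs `‖c‖ * S / 2`, absorbed because `S` is finite.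
  obtain ⟨k, hk_supp, hk_le, hk_cont, hk_int⟩ :=
    hg.exists_hasCompactSupport_integral_sub_le (ε := ‖c‖ / 4) (by positivity)
  have hk_mom : Integrable (fun t => |t| * ‖k t‖) volume :=
    (continuous_abs.mul hk_cont.norm).integrable_of_hasCompactSupport hk_supp.norm.mul_left
  have hd_int : Integrable (fun t => ‖g t - k t‖) volume := (hg.sub hk_int).norm
  refine ⟨2 * (L * (∫ t, |t| * ‖k t‖) / ‖c‖), fun u hu ⟨B, hB⟩ hL hconv => ?_⟩
  have hbdd : BddAbove (Set.range fun x => ‖u x‖) := ⟨B, by rintro _ ⟨x, rfl⟩; exact hB x⟩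
  set S := ⨆ x, ‖u x‖
  have hS : ∀ x, ‖u x‖ ≤ S := fun x => le_ciSup hbdd x
  have hint : ∀ x, Integrable (fun t => g t * u (x - t)) volume := fun x =>
    hg.mul_bdd (c := S) (hu.comp (by fun_prop)).aestronglyMeasurable
      (Filter.Eventually.of_forall fun t => hS _)
  have key : ∀ x, ‖u x‖ ≤ S / 2 + L * (∫ t, |t| * ‖k t‖) / ‖c‖ := by
    intro x
    have h1 : ∫ t, g t * (u x - u (x - t)) = c * u x := by
      simp_rw [mul_sub]
      rw [integral_sub (hg.mul_const _) (hint x), hconv x, sub_zero, integral_mul_const]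
    have h2 : ‖∫ t, g t * (u x - u (x - t))‖ ≤
        ∫ t, (2 * S * ‖g t - k t‖ + L * (|t| * ‖k t‖)) := by
      refine norm_integral_le_of_norm_le
        ((hd_int.const_mul _).add (hk_mom.const_mul _))
        (Filter.Eventually.of_forall fun t => ?_)
      have e : g t * (u x - u (x - t)) =
          (g t - k t) * (u x - u (x - t)) + k t * (u x - u (x - t)) := by ring
      rw [e]
      refine (norm_add_le _ _).trans (add_le_add ?_ ?_)
      · rw [norm_mul, mul_comm]
        gcongr
        linarith [norm_sub_le (u x) (u (x - t)), hS x, hS (x - t)]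
      · rw [norm_mul, mul_comm, ← mul_assoc]
        gcongr
        exact hL x t
    rw [h1, norm_mul, integral_add (hd_int.const_mul _) (hk_mom.const_mul _),
      integral_const_mul, integral_const_mul] at h2
    have hS0 : 0 ≤ S := (norm_nonneg _).trans (hS 0)
    have h3 : 2 * S * ∫ t, ‖g t - k t‖ ≤ 2 * S * (‖c‖ / 4) := by gcongr
    have h4 : ‖u x‖ ≤ (‖c‖ * (S / 2) + L * ∫ t, |t| * ‖k t‖) / ‖c‖ := by
      rw [le_div_iff₀ hc]
      linarith
    rwa [add_div, mul_div_cancel_left₀ _ hc.ne'] at h4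
  intro x
  linarith [hS x, ciSup_le key]

/-- If `g * φ = 0` almost everywhere, then `g` also annihilates the increments of a primitive
of `φ`. -/
theorem integral_mul_intervalIntegral_comp_sub_eq_zero {g φ : ℝ → ℂ} {M : ℝ}
    (hg : Integrable g volume) (hφ : AEStronglyMeasurable φ volume)
    (hM : ∀ᵐ x, ‖φ x‖ ≤ M) (hconv : ∀ᵐ s, ∫ t, g t * φ (s - t) = 0) (x h : ℝ) :
    ∫ t, g t * ∫ s in (x - t)..(x - t + h), φ s = 0 := by
  have hac : ((volume : Measure ℝ).restrict (Set.uIoc x (x + h))).prod (volume : Measure ℝ) ≪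
      (volume : Measure ℝ).prod volume :=
    Measure.restrict_le_self.absolutelyContinuous.prod Measure.AbsolutelyContinuous.rfl
  have hqmp := quasiMeasurePreserving_sub_of_right_invariant (volume : Measure ℝ) volume
  have : IsFiniteMeasure (volume.restrict (Set.uIoc x (x + h))) :=
    isFiniteMeasure_restrict.2 (by simp [Set.uIoc])
  have hint : Integrable (Function.uncurry fun s t : ℝ => g t * φ (s - t))
      (((volume : Measure ℝ).restrict (Set.uIoc x (x + h))).prod volume) := by
    have h1 : Integrable (fun p : ℝ × ℝ => g p.2)
        (((volume : Measure ℝ).restrict (Set.uIoc x (x + h))).prod volume) := hg.comp_snd _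
    exact h1.mul_bdd (c := M) ((hφ.comp_quasiMeasurePreserving hqmp).mono_ac hac)
      (hac.ae_le (hqmp.ae hM))
  have e : ∀ t, g t * ∫ s in (x - t)..(x - t + h), φ s =
      ∫ s in x..(x + h), g t * φ (s - t) := by
    intro t
    rw [intervalIntegral.integral_const_mul, intervalIntegral.integral_comp_sub_right,
      add_sub_right_comm]
  simp_rw [e]
  -- After Fubini the inner integral is `g * φ` at `s`, zero for almost every `s`.
  rw [← intervalIntegral_integral_swap hint]
  exact intervalIntegral.integral_zero_ae (hconv.mono fun s hs _ => hs)

theorem fourierHat_zero (f : ℝ → ℂ) : BeurlingSpectrum.fourierHat f 0 = ∫ x, f x := by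
  simp [BeurlingSpectrum.fourierHat]

theorem integral_invol (f : ℝ → ℂ) :
    ∫ x, BeurlingSpectrum.invol f x = conj (∫ x, f x) := by
  unfold BeurlingSpectrum.invol
  rw [integral_neg_eq_self (fun x => conj (f x)) volume, integral_conj]

theorem integrable_invol {f : ℝ → ℂ} (hf : Integrable f volume) :
    Integrable (BeurlingSpectrum.invol f) volume :=
  LinearIsometryEquiv.integrable_comp_iff Complex.conjLIE |>.2 hf.comp_neg

theorem corollary5p4 (φ : ℝ → ℂ) (hφ : MemLp φ ⊤ volume)
    (h0 : (0 : ℝ) ∉ BeurlingSpectrum.sp φ) :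
    ∃ C : ℝ, ∀ x : ℝ, ‖BeurlingSpectrum.indefiniteIntegral φ x‖ ≤ C := by
  simp only [BeurlingSpectrum.sp, Set.mem_ofPred_eq, not_forall] at h0
  obtain ⟨f, ⟨hf, hconv⟩, hf0⟩ := h0
  set M := lpNorm φ ⊤ volume
  have hM : ∀ᵐ x, ‖φ x‖ ≤ M := ae_le_lpNorm_exponent_top hφ
  have hint : ∀ a b : ℝ, IntervalIntegrable φ volume a b := fun a b =>
    (hφ.locallyIntegrable le_top).integrableOn_isCompact isCompact_uIcc |>.intervalIntegrable
  have hbound : ∀ a b : ℝ, ‖∫ s in a..b, φ s‖ ≤ M * |b - a| := fun a b =>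
    intervalIntegral.norm_integral_le_of_norm_le_const_ae (hM.mono fun x hx _ => hx)
  have hg0 : ∫ x, BeurlingSpectrum.invol f x ≠ 0 := by
    rw [integral_invol]
    rw [fourierHat_zero] at hf0
    simpa using hf0
  obtain ⟨K, hK⟩ := exists_norm_le_of_convolution_eq_zero (integrable_invol hf) hg0 (2 * M)
  refine ⟨K, fun h => ?_⟩
  have hcont : Continuous fun x : ℝ => ∫ s in x..(x + h), φ s := by
    have hP := intervalIntegral.continuous_primitive hint 0
    have e : (fun x : ℝ => ∫ s in x..(x + h), φ s) =
        fun x => (∫ s in (0 : ℝ)..(x + h), φ s) - ∫ s in (0 : ℝ)..x, φ s := by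
      ext x
      rw [intervalIntegral.integral_interval_sub_left (hint _ _) (hint _ _)]
    rw [e]
    exact (hP.comp (by fun_prop)).sub hP
  have := hK (fun x => ∫ s in x..(x + h), φ s) hcont
    ⟨M * |h|, fun x => by simpa using hbound x (x + h)⟩ (fun x t => ?_)
    (integral_mul_intervalIntegral_comp_sub_eq_zero (integrable_invol hf)
      hφ.aestronglyMeasurable hM hconv · h) 0
  · simpa [BeurlingSpectrum.indefiniteIntegral] using this
  -- The difference regroups into two integrals over intervals of length `|t|`, whence `2 * M`, free
  -- of `h`.
  · rw [intervalIntegral.integral_interval_sub_interval_comm' (hint _ _) (hint _ _) (hint _ _)]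
    refine (norm_sub_le _ _).trans ?_
    have h1 := hbound (x - t + h) (x + h)
    have h2 := hbound (x - t) x
    rw [show x + h - (x - t + h) = t by ring] at h1
    rw [sub_sub_cancel] at h2
    linarith
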